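/- Let $S$ be a countable set, let $(p_{ij})_{i,j\in S}$ be a stochastic matrix, and let $X_0,X_1,X_2,\dots$ be a (time-homogeneous) Markov chain with state space $S$ and transition matrix $(p_{ij})$, defined on a probability space $(\Omega,\mathcal F,P)$, with arbitrary initial distribution $\mu^{(0)}_i=P(X_0=i)$, $i\in S$. For $i,j\in S$ let $f_{ij}$ be the probability that the chain with transition matrix $(p_{ij})$ started at $i$ is in the state $j$ at some time $n\ge 1$, and let $m_j\in[1,\infty]$ be the mean recurrence time of $j$, that is, the expected value of $\min\{n\ge 1: X_n=j\}$ (with $\min\emptyset=\infty$) for the chain started at $j$. The state $j$ is transient if $f_{jj}<1$, positive recurrent if $f_{jj}=1$ and $m_j<\infty$, and null recurrent if $f_{jj}=1$ and $m_j=\infty$. Let $M_j(n)$ be the number of $k\in\{1,\dots,n\}$ with $X_k=j$. **Proposition.** Let $j\in S$. If $j$ is positive recurrent, then $$\Big\{\omega\in\Omega:\lim_{n\to\infty}\frac{M_j(n)}{n}=\frac1{m_j}\Big\}\cup\Big\{\omega\in\Omega:\lim_{n\to\infty}\frac{M_j(n)}{n}=0\Big\}=\Omega\smallsetminus E$$ for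 some event $E$ with $P(E)=0$; more precisely, $$P\Big(\lim_{n\to\infty}\frac{M_j(n)}{n}=\frac1{m_j}\Big)=\sum_{i\in S}\mu^{(0)}_i f_{ij}\qquad\text{and}\qquad P\Big(\lim_{n\to\infty}\frac{M_j(n)}{n}=0\Big)=\sum_{i\in S}\mu^{(0)}_i(1-f_{ij}).$$ If $j$ is null recurrent or transient, then $$P\Big(\lim_{n\to\infty}\frac{M_j(n)}{n}=0\Big)=1.$$ -/

import Mathlib

open MeasureTheory ProbabilityTheory Filter Topology
open scoped ENNReal

noncomputable section

namespace MarkovChain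

variable {S : Type*} [Countable S] [MeasurableSpace S] [MeasurableSingletonClass S]

/-- A stochastic matrix on the countable set `S` is given by its rows `p i`, each a probability
mass function. This is the one-step kernel: given the states at the times `0, …, n`, the state at
time `n + 1` has law `p i`, where `i` is the state at time `n`. -/
def stepKernel (p : S → PMF S) (n : ℕ) : Kernel (Finset.Iic n → S) S where
  toFun h := (p (h ⟨n, Finset.mem_Iic.2 le_rfl⟩)).toMeasure
  measurable' :=
    (measurable_of_countable fun i : S => (p i).toMeasure).comp (measurable_pi_apply _)

instance (p : S → PMF S) (n : ℕ) : IsMarkovKernel (stepKernel p n) :=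
  ⟨fun h => inferInstanceAs (IsProbabilityMeasure (p (h ⟨n, _⟩)).toMeasure)⟩

/-- The law, on the space `ℕ → S` of trajectories, of the Markov chain with transition matrix `p`
started at the state `i`. It is the measure of the Ionescu-Tulcea theorem. -/
def pathLaw (p : S → PMF S) (i : S) : Measure (ℕ → S) :=
  Kernel.traj (X := fun _ => S) (stepKernel p) 0 (fun _ => i)

/-- `f i j`, the probability that the chain started at `i` is in the state `j` at some time
`n ≥ 1`. -/
def hitProb (p : S → PMF S) (i j : S) : ℝ≥0∞ :=
  pathLaw p i {x | ∃ n, 1 ≤ n ∧ x n = j}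

/-- The first time `n ≥ 1` at which a trajectory is in the state `j` (`∞` if there is none). -/
def returnTime (j : S) (x : ℕ → S) : ℝ≥0∞ :=
  ⨅ (n : ℕ) (_ : 1 ≤ n ∧ x n = j), (n : ℝ≥0∞)

/-- `m j`, the mean recurrence time of `j`: the expected number of transitions that the chain
started at `j` needs to return to `j`. -/
def meanReturnTime (p : S → PMF S) (j : S) : ℝ≥0∞ :=
  ∫⁻ x, returnTime j x ∂(pathLaw p j)

def IsRecurrent (p : S → PMF S) (j : S) : Prop := hitProb p j j = 1

def IsTransient (p : S → PMF S) (j : S) : Prop := hitProb p j j < 1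

def IsPositiveRecurrent (p : S → PMF S) (j : S) : Prop :=
  IsRecurrent p j ∧ meanReturnTime p j < ∞

def IsNullRecurrent (p : S → PMF S) (j : S) : Prop :=
  IsRecurrent p j ∧ meanReturnTime p j = ∞

/-- `X` is a (time-homogeneous) Markov chain on the probability space `(Ω, μ)` with transition
matrix `p`: `μ(X (n+1) = j | X 0 = s 0, …, X n = s n) = p (s n) j` whenever the conditioning event
has positive probability. The initial distribution is arbitrary. -/
structure IsMarkovChain {Ω : Type*} [MeasurableSpace Ω] (μ : Measure Ω) (p : S → PMF S)
    (X : ℕ → Ω → S) : Prop where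
  measurable (n : ℕ) : Measurable (X n)
  markov (n : ℕ) (s : ℕ → S) (j : S) :
    μ {ω | ∀ k ≤ n, X k ω = s k} ≠ 0 →
      cond μ {ω | ∀ k ≤ n, X k ω = s k} {ω | X (n + 1) ω = j} = p (s n) j

/-- `M_j(n)`, the number of times `k` with `1 ≤ k ≤ n` at which `X k = j`. -/
def visits {Ω : Type*} (X : ℕ → Ω → S) (j : S) (n : ℕ) (ω : Ω) : ℝ :=
  ∑ k ∈ Finset.Icc 1 n, Set.indicator {j} (fun _ => (1 : ℝ)) (X k ω)

/-- The event that `M_j(n) / n` tends to `a` as `n → ∞`. -/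
def freqTendsto {Ω : Type*} (X : ℕ → Ω → S) (j : S) (a : ℝ) : Set Ω :=
  {ω | Tendsto (fun n : ℕ => visits X j n ω / n) atTop (𝓝 a)}

end MarkovChain

end

/-!
The law of the chain is the mixture of the laws `pathLaw p i` by the initial distribution
(`MarkovChain.IsMarkovChain.map_eq_sum`), because both give every cylinder the same probability.
So it suffices to find, for each `i`, the probabilities of the two events for the chain started
at `i`.

The main tool is the strong Markov property at the first visit to `j`
(`MarkovChain.pathLaw_firstHit_inter_afterHit`): given that the chain reaches `j`, the trajectory
after this visit has the law `pathLaw p j` and is independent of the time of the visit. The limit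
of the frequency of visits to `j` is not changed by a shift, and it is `0` along a trajectory that
never reaches `j`. Hence the probability that `j` is reached and the frequency tends to `a` is
`f i j` times the probability that it tends to `a` for the chain started at `j`
(`MarkovChain.pathLaw_hits_inter`), and only the chain started at `j` is left.

* If `j` is transient, let `q` be the probability, from `j`, that the frequency does not tend to
  `0`. Then `q = f j j * q` with `f j j < 1`, so `q = 0`.
* If `j` is recurrent, the passage to the trajectory after the first return preserves `pathLaw p j`,
  and the first return time is independent of it. So the times between consecutive returns are
  identically distributed and pairwise independent, which is all that Etemadi's strong law needs
  (`MarkovChain.IsRecurrent.ae_tendsto_average`). If the mean return time `m` is finite, then the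
  time `T k` of the `k`-th return satisfies `T k / k → m`; if it is infinite, the strong law for the
  truncated return times gives `T k / k → ∞`. As `M_j (T k) = k` and `M_j` is monotone, `M_j n / n`
  has the same limit as `k / T k` (`MarkovChain.tendsto_div_of_tendsto_div`).
-/

namespace MarkovChain

/-! ### Cylinders -/

/-- The cylinder of all trajectories that agree with `s` at the times `0, …, n`. -/
def pathCylinder {S : Type*} (n : ℕ) (s : ℕ → S) : Set (ℕ → S) := {x | ∀ k ≤ n, x k = s k}

/-- The trajectory seen from time `r` on. -/
def shift {S : Type*} (r : ℕ) (x : ℕ → S) : ℕ → S := fun n => x (n + r)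

theorem pathCylinder_eq_preimage {S : Type*} (n : ℕ) (s : ℕ → S) :
    pathCylinder n s = Preorder.frestrictLe (π := fun _ => S) n ⁻¹'
      {Preorder.frestrictLe (π := fun _ => S) n s} := by
  ext x
  simp only [pathCylinder, Set.mem_ofPred_eq, Set.mem_preimage, Set.mem_singleton_iff, funext_iff,
    Preorder.frestrictLe_apply, Subtype.forall, Finset.mem_Iic]

theorem exists_frestrictLe_eq {S : Type*} (n : ℕ) (w : Finset.Iic n → S) :
    ∃ s : ℕ → S, Preorder.frestrictLe (π := fun _ => S) n s = w := by
  refine ⟨fun k => w ⟨min k n, Finset.mem_Iic.2 (min_le_right _ _)⟩, ?_⟩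
  ext ⟨k, hk⟩
  simp [min_eq_left (Finset.mem_Iic.1 hk)]

theorem measurable_shift {S : Type*} [MeasurableSpace S] (r : ℕ) :
    Measurable (shift (S := S) r) :=
  measurable_pi_lambda _ fun _ => measurable_pi_apply _

theorem measurableSet_pathCylinder {S : Type*} [MeasurableSpace S] [MeasurableSingletonClass S]
    (n : ℕ) (s : ℕ → S) : MeasurableSet (pathCylinder n s) := by
  rw [pathCylinder_eq_preimage]
  exact Preorder.measurable_frestrictLe n (measurableSet_singleton _)

theorem measurableSet_apply_eq {S : Type*} [MeasurableSpace S] [MeasurableSingletonClass S]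
    (n : ℕ) (a : S) : MeasurableSet {x : ℕ → S | x n = a} := by
  have h : {x : ℕ → S | x n = a} = (fun x => x n) ⁻¹' {a} := rfl
  rw [h]
  exact measurable_pi_apply n (measurableSet_singleton a)

/-- If `f` takes countably many values, a product formula for the events `f = w` extends to the
events `f ∈ W`. -/
theorem measure_preimage_inter_eq_mul {α β : Type*} [MeasurableSpace α] [Countable β]
    [MeasurableSpace β] [MeasurableSingletonClass β] (P : Measure α) {f : α → β}
    (hf : Measurable f) (W : Set β) (B : Set α) (c : ℝ≥0∞)
    (h : ∀ w ∈ W, P (f ⁻¹' {w} ∩ B) = P (f ⁻¹' {w}) * c) :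
    P (f ⁻¹' W ∩ B) = P (f ⁻¹' W) * c := by
  have hm : ∀ y ∈ W, MeasurableSet (f ⁻¹' {y}) := fun y _ => hf (measurableSet_singleton y)
  have hW : MeasurableSet (f ⁻¹' W) := hf W.to_countable.measurableSet
  rw [← Measure.restrict_apply hW, ← tsum_measure_preimage_singleton W.to_countable hm,
    ← tsum_measure_preimage_singleton W.to_countable hm, ← ENNReal.tsum_mul_right]
  refine tsum_congr fun w => ?_
  rw [Measure.restrict_apply (hm w w.2), h w w.2]

/-! ### The law of a Markov chain -/

/-- The Markov property determines the probability of every cylinder from the law of `X 0`. -/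
theorem IsMarkovChain.measure_path {S Ω : Type*} [MeasurableSpace S]
    [MeasurableSingletonClass S] [MeasurableSpace Ω] {μ : Measure Ω} [IsProbabilityMeasure μ]
    {p : S → PMF S} {X : ℕ → Ω → S} (hX : IsMarkovChain μ p X) (n : ℕ) (s : ℕ → S) :
    μ {ω | ∀ k ≤ n, X k ω = s k} =
      μ {ω | X 0 ω = s 0} * ∏ k ∈ Finset.range n, p (s k) (s (k + 1)) := by
  induction n with
  | zero => simp
  | succ n ih =>
    have hm : MeasurableSet {ω | ∀ k ≤ n, X k ω = s k} := by
      have : {ω | ∀ k ≤ n, X k ω = s k} = ⋂ k ∈ Set.Iic n, X k ⁻¹' {s k} := by ext; simp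
      rw [this]
      exact MeasurableSet.biInter (Set.to_countable _) fun k _ =>
        hX.measurable k (measurableSet_singleton _)
    have hs : {ω | ∀ k ≤ n + 1, X k ω = s k} =
        {ω | ∀ k ≤ n, X k ω = s k} ∩ {ω | X (n + 1) ω = s (n + 1)} := by
      ext ω
      refine ⟨fun h => ⟨fun k hk => h k (by lia), h _ le_rfl⟩, fun h k hk => ?_⟩
      rcases Nat.le_succ_iff.1 hk with hk | rfl
      exacts [h.1 k hk, h.2]
    rw [Finset.prod_range_succ, ← mul_assoc, ← ih, hs]
    by_cases h0 : μ {ω | ∀ k ≤ n, X k ω = s k} = 0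
    · rw [h0, zero_mul]
      exact measure_mono_null Set.inter_subset_left h0
    · rw [← cond_mul_eq_inter hm, hX.markov n s _ h0, mul_comm]

section Law

variable {S : Type*} [Countable S] [MeasurableSpace S] [MeasurableSingletonClass S]

/-- A finite measure on the space of trajectories is determined by the cylinders. -/
theorem ext_of_pathCylinder {P Q : Measure (ℕ → S)} [IsFiniteMeasure P]
    (h : ∀ n s, P (pathCylinder n s) = Q (pathCylinder n s)) : P = Q := by
  have hr : ∀ I : Finset ℕ, Measurable (Finset.restrict (π := fun _ => S) I) := fun I => by fun_prop
  have key : ∀ n, P.map (Preorder.frestrictLe (π := fun _ => S) n) =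
      Q.map (Preorder.frestrictLe n) := by
    intro n
    refine Measure.ext_of_singleton fun w => ?_
    obtain ⟨s, rfl⟩ := exists_frestrictLe_eq n w
    rw [Measure.map_apply (Preorder.measurable_frestrictLe n) (measurableSet_singleton _),
      Measure.map_apply (Preorder.measurable_frestrictLe n) (measurableSet_singleton _),
      ← pathCylinder_eq_preimage, h]
  have hP : IsProjectiveMeasureFamily (α := fun _ => S) fun I : Finset ℕ =>
      P.map (Finset.restrict (π := fun _ => S) I) := by
    intro I J hJI
    exact (Measure.map_map (Finset.measurable_restrict₂ (X := fun _ => S) hJI) (hr I)).symm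
  refine IsProjectiveLimit.unique (α := fun _ => S)
    (P := fun I : Finset ℕ => P.map (Finset.restrict (π := fun _ => S) I))
    (fun I => rfl) ?_
  rw [isProjectiveLimit_nat_iff hP]
  exact fun n => (key n).symm

instance (p : S → PMF S) (i : S) : IsProbabilityMeasure (pathLaw p i) := by
  unfold pathLaw
  infer_instance

/-- Under `pathLaw p i` the coordinate process is a Markov chain with transition matrix `p`. -/
theorem isMarkovChain_pathLaw (p : S → PMF S) (i : S) :
    IsMarkovChain (pathLaw p i) p (fun n x => x n) where
  measurable n := measurable_pi_apply n
  markov n s j h := by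
    have hm := measurableSet_pathCylinder n s
    have hc : pathLaw p i (pathCylinder n s ∩ {x | x (n + 1) = j}) =
        pathLaw p i (pathCylinder n s) * p (s n) j := by
      have key := congrArg (fun m => m ({Preorder.frestrictLe (π := fun _ => S) n s} ×ˢ {j}))
        (Kernel.partialTraj_compProd_eq_map_traj (X := fun _ => S) (κ := stepKernel p)
          (Nat.zero_le n) (x₀ := fun _ => i))
      beta_reduce at key
      rw [Measure.compProd_apply_prod (measurableSet_singleton _) (measurableSet_singleton _),
        Measure.map_apply (by fun_prop)
          ((measurableSet_singleton _).prod (measurableSet_singleton _)),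
        lintegral_singleton, ← Kernel.traj_map_frestrictLe_apply,
        Measure.map_apply (Preorder.measurable_frestrictLe n) (measurableSet_singleton _),
        ← pathCylinder_eq_preimage] at key
      rw [pathCylinder_eq_preimage] at key ⊢
      refine key.symm.trans ?_
      rw [mul_comm]
      congr 1
      exact (p (s n)).toMeasure_apply_singleton j (measurableSet_singleton j)
    change pathLaw p i (pathCylinder n s) ≠ 0 at h
    change ProbabilityTheory.cond _ (pathCylinder n s) _ = _
    rw [cond_apply hm, hc, ← mul_assoc, ENNReal.inv_mul_cancel h (measure_ne_top _ _), one_mul]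

theorem pathLaw_start_self (p : S → PMF S) (i : S) : pathLaw p i {x | x 0 = i} = 1 := by
  have h := Kernel.traj_map_frestrictLe_apply (X := fun _ => S) (κ := stepKernel p) 0 0
    (fun _ => i)
  rw [Kernel.partialTraj_self, Kernel.id_apply] at h
  have hs : {x : ℕ → S | x 0 = i} =
      Preorder.frestrictLe (π := fun _ => S) 0 ⁻¹' {fun _ => i} := by
    rw [show {x : ℕ → S | x 0 = i} = pathCylinder 0 (fun _ => i) by ext x; simp [pathCylinder],
      pathCylinder_eq_preimage]
    rfl
  rw [hs, pathLaw, ← Measure.map_apply (Preorder.measurable_frestrictLe 0)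
    (measurableSet_singleton _), h, Measure.dirac_apply' _ (measurableSet_singleton _)]
  simp

theorem pathLaw_start_of_ne (p : S → PMF S) {i a : S} (h : a ≠ i) :
    pathLaw p i {x | x 0 = a} = 0 := by
  have hm := measurableSet_apply_eq 0 i
  refine measure_mono_null (t := {x : ℕ → S | x 0 = i}ᶜ) ?_ ?_
  · rintro x rfl
    exact h
  · rw [prob_compl_eq_zero_iff hm, pathLaw_start_self]

theorem pathLaw_pathCylinder (p : S → PMF S) (i : S) (n : ℕ) (s : ℕ → S) :
    pathLaw p i (pathCylinder n s) =
      pathLaw p i {x | x 0 = s 0} * ∏ k ∈ Finset.range n, p (s k) (s (k + 1)) :=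
  (isMarkovChain_pathLaw p i).measure_path n s

/-- The law of a Markov chain is the mixture of the laws `pathLaw p i` by its initial
distribution. -/
theorem IsMarkovChain.map_eq_sum {Ω : Type*} [MeasurableSpace Ω] {μ : Measure Ω}
    [IsProbabilityMeasure μ] {p : S → PMF S} {X : ℕ → Ω → S} (hX : IsMarkovChain μ p X) :
    μ.map (fun ω n => X n ω) = Measure.sum fun i => μ {ω | X 0 ω = i} • pathLaw p i := by
  have hm : Measurable fun ω n => X n ω := measurable_pi_lambda _ hX.measurable
  refine ext_of_pathCylinder fun n s => ?_
  rw [Measure.map_apply hm (measurableSet_pathCylinder n s),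
    Measure.sum_apply _ (measurableSet_pathCylinder n s), tsum_eq_single (s 0)]
  · rw [Measure.smul_apply, pathLaw_pathCylinder, pathLaw_start_self, one_mul, smul_eq_mul]
    exact hX.measure_path n s
  · intro i hi
    rw [Measure.smul_apply, pathLaw_pathCylinder, pathLaw_start_of_ne p hi.symm, zero_mul,
      smul_zero]

theorem IsMarkovChain.measure_eq_tsum {Ω : Type*} [MeasurableSpace Ω] {μ : Measure Ω}
    [IsProbabilityMeasure μ] {p : S → PMF S} {X : ℕ → Ω → S} (hX : IsMarkovChain μ p X)
    {A : Set (ℕ → S)} (hA : MeasurableSet A) :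
    μ {ω | (fun n => X n ω) ∈ A} = ∑' i, μ {ω | X 0 ω = i} * pathLaw p i A := by
  have hm : Measurable fun ω n => X n ω := measurable_pi_lambda _ hX.measurable
  have h := Measure.map_apply (μ := μ) hm hA
  rw [hX.map_eq_sum, Measure.sum_apply _ hA] at h
  exact h.symm

/-! ### The Markov property -/

/-- The Markov property at the fixed time `r`, for a cylinder as the past and as the future. -/
theorem pathLaw_pathCylinder_inter_shift_pathCylinder (p : S → PMF S) (i : S) (r : ℕ) (s : ℕ → S)
    (n : ℕ) (t : ℕ → S) :
    pathLaw p i (pathCylinder r s ∩ shift r ⁻¹' pathCylinder n t) =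
      pathLaw p i (pathCylinder r s) * pathLaw p (s r) (pathCylinder n t) := by
  by_cases h : t 0 = s r
  · -- The two cylinders are glued to one cylinder of length `r + n`.
    have hu : pathCylinder r s ∩ shift r ⁻¹' pathCylinder n t =
        pathCylinder (r + n) (fun k => if k ≤ r then s k else t (k - r)) := by
      ext x
      simp only [pathCylinder, shift, Set.mem_inter_iff, Set.mem_ofPred_eq, Set.mem_preimage]
      refine ⟨fun ⟨h1, h2⟩ k hk => ?_, fun hx => ⟨fun k hk => ?_, fun k hk => ?_⟩⟩
      · split_ifs with hkr
        · exact h1 k hkr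
        · rw [← h2 (k - r) (by lia), Nat.sub_add_cancel (by lia)]
      · rw [hx k (by lia), if_pos hk]
      · rw [hx (k + r) (by lia)]
        split_ifs with hkr
        · obtain rfl : k = 0 := by lia
          rw [h, zero_add]
        · rw [Nat.add_sub_cancel]
    rw [hu, pathLaw_pathCylinder, pathLaw_pathCylinder, pathLaw_pathCylinder, h,
      pathLaw_start_self, one_mul, mul_assoc, Finset.prod_range_add]
    congr 2
    · refine Finset.prod_congr rfl fun k hk => ?_
      have hk := Finset.mem_range.1 hk
      rw [if_pos hk.le, if_pos (by lia)]
    · refine Finset.prod_congr rfl fun k _ => ?_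
      rw [if_neg (c := r + k + 1 ≤ r) (by lia), show r + k + 1 - r = k + 1 by lia]
      rcases Nat.eq_zero_or_pos k with rfl | hk
      · rw [if_pos (by lia), h, add_zero]
      · rw [if_neg (by lia), Nat.add_sub_cancel_left]
  · rw [pathLaw_pathCylinder p (s r), pathLaw_start_of_ne p h, zero_mul, mul_zero]
    refine measure_mono_null (t := ∅) ?_ measure_empty
    rintro x ⟨h1, h2⟩
    exact h ((h2 0 (Nat.zero_le n)).symm.trans (by simpa [shift] using h1 r le_rfl))

/-- The Markov property at the fixed time `r`, for a cylinder as the past and any event as the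
future. -/
theorem pathLaw_pathCylinder_inter_shift (p : S → PMF S) (i : S) (r : ℕ) (s : ℕ → S)
    {A : Set (ℕ → S)} (hA : MeasurableSet A) :
    pathLaw p i (pathCylinder r s ∩ shift r ⁻¹' A) =
      pathLaw p i (pathCylinder r s) * pathLaw p (s r) A := by
  have h : ((pathLaw p i).restrict (pathCylinder r s)).map (shift r) =
      pathLaw p i (pathCylinder r s) • pathLaw p (s r) := by
    refine ext_of_pathCylinder fun n t => ?_
    have ht := measurableSet_pathCylinder n t
    rw [Measure.map_apply (measurable_shift r) ht,
      Measure.restrict_apply (measurable_shift r ht), Set.inter_comm,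
      pathLaw_pathCylinder_inter_shift_pathCylinder, Measure.smul_apply, smul_eq_mul]
  have h' := congrArg (fun m => m A) h
  rwa [Measure.map_apply (measurable_shift r) hA,
    Measure.restrict_apply (measurable_shift r hA), Set.inter_comm, Measure.smul_apply,
    smul_eq_mul] at h'

end Law

/-! ### The first visit to a state -/

section Return

variable {S : Type*}

/-- The trajectories that are in the state `j` at some time `n ≥ 1`. -/
def hits (j : S) : Set (ℕ → S) := {x | ∃ n, 1 ≤ n ∧ x n = j}

/-- The first time `n ≥ 1` at which a trajectory is in the state `j`, as a natural number; it is
`0` if there is no such time. -/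
noncomputable def firstHit (j : S) (x : ℕ → S) : ℕ := sInf {n | 1 ≤ n ∧ x n = j}

/-- The trajectory seen from its first visit to `j` on (the trajectory itself, if it never
visits `j`). -/
noncomputable def afterHit (j : S) (x : ℕ → S) : ℕ → S := shift (firstHit j x) x

theorem firstHit_spec {j : S} {x : ℕ → S} (h : x ∈ hits j) :
    1 ≤ firstHit j x ∧ x (firstHit j x) = j :=
  Nat.sInf_mem (s := {n | 1 ≤ n ∧ x n = j}) h

theorem firstHit_le {j : S} {x : ℕ → S} {n : ℕ} (h1 : 1 ≤ n) (h : x n = j) :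
    firstHit j x ≤ n :=
  Nat.sInf_le (s := {n | 1 ≤ n ∧ x n = j}) ⟨h1, h⟩

theorem firstHit_ne_zero_iff {j : S} {x : ℕ → S} : firstHit j x ≠ 0 ↔ x ∈ hits j := by
  refine ⟨fun h => ?_, fun h => by have := (firstHit_spec h).1; lia⟩
  obtain ⟨n, hn⟩ := Nat.nonempty_of_pos_sInf (Nat.pos_of_ne_zero h)
  exact ⟨n, hn⟩

theorem hits_eq_preimage (j : S) : hits j = firstHit j ⁻¹' {0}ᶜ := by
  ext x
  exact firstHit_ne_zero_iff.symm

theorem returnTime_eq {j : S} {x : ℕ → S} (h : x ∈ hits j) :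
    returnTime j x = (firstHit j x : ℝ≥0∞) :=
  le_antisymm (iInf₂_le (f := fun n (_ : 1 ≤ n ∧ x n = j) => (n : ℝ≥0∞)) _ (firstHit_spec h))
    (le_iInf₂ fun _ hn => Nat.cast_le.2 (firstHit_le hn.1 hn.2))

/-- Whether the first hit happens at the positive time `r` is decided by the states at the times
`0, …, r`. -/
theorem firstHit_preimage_eq (j : S) {r : ℕ} (hr : r ≠ 0) :
    firstHit j ⁻¹' {r} = Preorder.frestrictLe (π := fun _ => S) r ⁻¹'
      {w | w ⟨r, Finset.mem_Iic.2 le_rfl⟩ = j ∧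
        ∀ k : Finset.Iic r, 1 ≤ k.1 → k.1 < r → w k ≠ j} := by
  ext x
  simp only [Set.mem_preimage, Set.mem_singleton_iff, Set.mem_ofPred_eq,
    Preorder.frestrictLe_apply]
  constructor
  · rintro rfl
    refine ⟨(firstHit_spec (firstHit_ne_zero_iff.1 hr)).2, fun k h1 hk h => ?_⟩
    exact (firstHit_le h1 h).not_gt hk
  · rintro ⟨h1, h2⟩
    have hx : x ∈ hits j := ⟨r, by lia, h1⟩
    have hle := firstHit_le (n := r) (by lia) h1
    by_contra hne
    exact h2 ⟨firstHit j x, Finset.mem_Iic.2 hle⟩ (firstHit_spec hx).1 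
      (lt_of_le_of_ne hle hne) (firstHit_spec hx).2

variable [MeasurableSpace S] [MeasurableSingletonClass S]

theorem measurableSet_hits (j : S) : MeasurableSet (hits j) := by
  have h : hits j = ⋃ n : Set.Ici 1, {x | x n.1 = j} := by
    ext x
    simp [hits]
  rw [h]
  exact MeasurableSet.iUnion fun n => measurableSet_apply_eq n.1 j

variable [Countable S]

theorem measurable_firstHit (j : S) : Measurable (firstHit j) := by
  refine measurable_to_countable' fun r => ?_
  rcases eq_or_ne r 0 with rfl | hr
  · have h : firstHit j ⁻¹' {0} = (hits j)ᶜ := by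
      rw [hits_eq_preimage, Set.preimage_compl, compl_compl]
    rw [h]
    exact (measurableSet_hits j).compl
  · rw [firstHit_preimage_eq j hr]
    exact Preorder.measurable_frestrictLe r (Set.to_countable _).measurableSet

theorem measurable_afterHit (j : S) : Measurable (afterHit j) := by
  have h : Measurable fun q : ℕ × (ℕ → S) => shift q.1 q.2 :=
    measurable_from_prod_countable_right fun r => measurable_shift r
  exact h.comp ((measurable_firstHit j).prodMk measurable_id)

/-- The strong Markov property at the first visit to `j`: the trajectory after this visit has the
law of the chain started at `j`, and it is independent of the time of the visit. -/
theorem pathLaw_firstHit_inter_afterHit (p : S → PMF S) (i j : S) {s : Set ℕ} (hs : 0 ∉ s)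
    {A : Set (ℕ → S)} (hA : MeasurableSet A) :
    pathLaw p i (firstHit j ⁻¹' s ∩ afterHit j ⁻¹' A) =
      pathLaw p i (firstHit j ⁻¹' s) * pathLaw p j A := by
  refine measure_preimage_inter_eq_mul _ (measurable_firstHit j) s _ _ fun r hr => ?_
  have hr0 : r ≠ 0 := fun h => hs (h ▸ hr)
  have hshift : firstHit j ⁻¹' {r} ∩ afterHit j ⁻¹' A =
      firstHit j ⁻¹' {r} ∩ shift r ⁻¹' A := by
    ext x
    refine and_congr_right fun hx => ?_
    have hx : firstHit j x = r := hx
    rw [Set.mem_preimage, Set.mem_preimage, afterHit, hx]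
  rw [hshift, firstHit_preimage_eq j hr0]
  refine measure_preimage_inter_eq_mul _ (Preorder.measurable_frestrictLe r) _ _ _ fun w hw => ?_
  obtain ⟨t, rfl⟩ := exists_frestrictLe_eq r w
  have ht : t r = j := hw.1
  rw [← pathCylinder_eq_preimage, pathLaw_pathCylinder_inter_shift p i r t hA, ht]

/-- If membership in `A` does not depend on what happens before the first visit to `j`, then the
chain reaches `j` and has a trajectory in `A` with probability `f i j` times the probability of
`A` for the chain started at `j`. -/
theorem pathLaw_hits_inter (p : S → PMF S) (i j : S) {A : Set (ℕ → S)} (hA : MeasurableSet A)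
    (hinv : ∀ x ∈ hits j, afterHit j x ∈ A ↔ x ∈ A) :
    pathLaw p i (hits j ∩ A) = hitProb p i j * pathLaw p j A := by
  have h : hits j ∩ A = firstHit j ⁻¹' {0}ᶜ ∩ afterHit j ⁻¹' A := by
    rw [← hits_eq_preimage]
    ext x
    exact and_congr_right fun hx => (hinv x hx).symm
  rw [h, pathLaw_firstHit_inter_afterHit p i j (by simp) hA, ← hits_eq_preimage]
  rfl

end Return

/-! ### The frequency of visits along a trajectory -/

section Frequency

variable {S : Type*}

/-- The number of visits to `j` at the times `1, …, n` along a trajectory. -/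
noncomputable abbrev pathVisits (j : S) (n : ℕ) (x : ℕ → S) : ℝ :=
  visits (fun n (x : ℕ → S) => x n) j n x

/-- The set of trajectories whose frequency of visits to `j` tends to `a`. -/
abbrev pathFreqTendsto (j : S) (a : ℝ) : Set (ℕ → S) :=
  freqTendsto (fun n (x : ℕ → S) => x n) j a

theorem pathVisits_zero (j : S) (x : ℕ → S) : pathVisits j 0 x = 0 := by
  simp [visits]

theorem pathVisits_succ (j : S) (n : ℕ) (x : ℕ → S) :
    pathVisits j (n + 1) x =
      pathVisits j n x + Set.indicator {j} (fun _ => (1 : ℝ)) (x (n + 1)) := by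
  simp only [visits]
  exact Finset.sum_Icc_succ_top (by lia) _

theorem pathVisits_mono (j : S) (x : ℕ → S) : Monotone fun n => pathVisits j n x := by
  refine monotone_nat_of_le_succ fun n => ?_
  rw [pathVisits_succ]
  exact le_add_of_nonneg_right (Set.indicator_nonneg (fun _ _ => zero_le_one) _)

theorem pathVisits_le (j : S) (n : ℕ) (x : ℕ → S) : pathVisits j n x ≤ n := by
  refine (Finset.sum_le_card_nsmul _ _ 1 fun k _ => ?_).trans (by simp)
  exact Set.indicator_le_self' (fun _ _ => zero_le_one) _

theorem pathVisits_add (j : S) (r n : ℕ) (x : ℕ → S) :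
    pathVisits j (n + r) x = pathVisits j r x + pathVisits j n (shift r x) := by
  induction n with
  | zero => rw [zero_add, pathVisits_zero, add_zero]
  | succ n ih =>
    rw [show n + 1 + r = n + r + 1 by lia, pathVisits_succ, pathVisits_succ, ih, add_assoc]
    simp only [shift, show n + r + 1 = n + 1 + r by lia]

theorem pathVisits_eq_zero {j : S} {n : ℕ} {x : ℕ → S} (h : ∀ k, 1 ≤ k → k ≤ n → x k ≠ j) :
    pathVisits j n x = 0 :=
  Finset.sum_eq_zero fun k hk =>
    Set.indicator_of_notMem (s := {j}) (h k (Finset.mem_Icc.1 hk).1 (Finset.mem_Icc.1 hk).2) _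

theorem pathVisits_firstHit {j : S} {x : ℕ → S} (h : x ∈ hits j) :
    pathVisits j (firstHit j x) x = 1 := by
  obtain ⟨h1, h2⟩ := firstHit_spec h
  obtain ⟨m, hm⟩ := Nat.exists_eq_add_of_le' h1
  rw [hm] at h2 ⊢
  rw [pathVisits_succ, h2, Set.indicator_of_mem (Set.mem_singleton j), pathVisits_eq_zero, zero_add]
  intro k hk hkm hxk
  have := firstHit_le hk hxk
  lia

/-- A shift changes the number of visits by a bounded amount, hence does not change the limit of
the frequency. -/
theorem shift_mem_pathFreqTendsto_iff {j : S} {a : ℝ} (r : ℕ) (x : ℕ → S) :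
    shift r x ∈ pathFreqTendsto j a ↔ x ∈ pathFreqTendsto j a := by
  have hb : ∀ n, |pathVisits j n x - pathVisits j n (shift r x)| ≤ r := by
    intro n
    have h1 := pathVisits_add j r n x
    have h2 := pathVisits_add j n r x
    have h3 := pathVisits_mono j x (Nat.le_add_right n r)
    have h4 := pathVisits_le j r x
    have h5 := pathVisits_le j r (shift n x)
    have h6 := pathVisits_mono j x (Nat.zero_le r)
    simp only [pathVisits_zero] at h3 h6
    rw [add_comm] at h2
    rw [abs_le]
    constructor <;> linarith
  have hd : Tendsto (fun n : ℕ => pathVisits j n x / n - pathVisits j n (shift r x) / n) atTop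
      (𝓝 0) := by
    refine squeeze_zero_norm (fun n => ?_) (tendsto_const_div_atTop_nhds_zero_nat (r : ℝ))
    rw [← sub_div, Real.norm_eq_abs, abs_div, Nat.abs_cast]
    exact div_le_div_of_nonneg_right (hb n) n.cast_nonneg
  constructor
  · intro h
    have h' := hd.add h
    simp only [sub_add_cancel, zero_add] at h'
    exact h'
  · intro h
    have h' := Tendsto.sub h hd
    simp only [sub_sub_cancel, sub_zero] at h'
    exact h'

theorem afterHit_mem_pathFreqTendsto_iff {j : S} {a : ℝ} (x : ℕ → S) :
    afterHit j x ∈ pathFreqTendsto j a ↔ x ∈ pathFreqTendsto j a :=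
  shift_mem_pathFreqTendsto_iff _ x

theorem mem_pathFreqTendsto_of_notMem_hits {j : S} {x : ℕ → S} (h : x ∉ hits j) :
    x ∈ pathFreqTendsto j 0 := by
  have h0 : ∀ n, pathVisits j n x = 0 := fun n =>
    pathVisits_eq_zero fun k hk _ hx => h ⟨k, hk, hx⟩
  refine Tendsto.congr (f₁ := fun _ => (0 : ℝ)) (fun n => ?_) tendsto_const_nhds
  exact (by rw [h0, zero_div] : (0 : ℝ) = pathVisits j n x / n)

theorem disjoint_pathFreqTendsto {j : S} {a b : ℝ} (h : a ≠ b) :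
    Disjoint (pathFreqTendsto j a) (pathFreqTendsto j b) :=
  Set.disjoint_left.2 fun _ ha hb => h (tendsto_nhds_unique ha hb)

theorem measurableSet_pathFreqTendsto [MeasurableSpace S] [MeasurableSingletonClass S] (j : S)
    (a : ℝ) : MeasurableSet (pathFreqTendsto j a) := by
  refine measurableSet_tendsto (f := fun (n : ℕ) x => pathVisits j n x / n) (𝓝 a) fun n => ?_
  refine Measurable.div_const (Finset.measurable_sum _ fun k _ => ?_) _
  exact (measurable_const.indicator (measurableSet_singleton j)).comp (measurable_pi_apply k)

/-- If `v` counts the terms of the strictly increasing sequence `T 1, T 2, …` up to a given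
number, then `v n / n` has the same limit as `k / T k`. -/
theorem tendsto_div_of_tendsto_div {v : ℕ → ℝ} {T : ℕ → ℕ} (hv : Monotone v) (hT : StrictMono T)
    (hT0 : T 0 = 0) (hvT : ∀ k, v (T k) = k) {L : ℝ}
    (hL : Tendsto (fun k : ℕ => (k : ℝ) / T k) atTop (𝓝 L)) :
    Tendsto (fun n : ℕ => v n / n) atTop (𝓝 L) := by
  have hex : ∀ n, ∃ k, T k ≤ n ∧ n < T (k + 1) := by
    intro n
    have hn : ∃ k, n < T k := ⟨n + 1, hT.le_apply (x := n + 1)⟩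
    classical
    have hpos : Nat.find hn ≠ 0 := fun h => by
      have := Nat.find_spec hn
      rw [h, hT0] at this
      lia
    obtain ⟨k, hk⟩ := Nat.exists_eq_succ_of_ne_zero hpos
    refine ⟨k, not_lt.1 (Nat.find_min hn (by lia)), ?_⟩
    have := Nat.find_spec hn
    rwa [hk] at this
  -- `κ n` is the number of terms of the sequence `T 1, T 2, …` that are at most `n`.
  choose κ hκ1 hκ2 using hex
  have hκ : Tendsto κ atTop atTop := by
    refine tendsto_atTop.2 fun K => (eventually_ge_atTop (T K)).mono fun n hn => ?_
    exact Nat.lt_succ_iff.1 (hT.lt_iff_lt.1 (hn.trans_lt (hκ2 n)))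
  have hTinv : Tendsto (fun k => ((T k : ℝ))⁻¹) atTop (𝓝 0) :=
    tendsto_inv_atTop_zero.comp (tendsto_natCast_atTop_atTop.comp hT.tendsto_atTop)
  have hlo : Tendsto (fun k : ℕ => ((k + 1 : ℕ) : ℝ) / T (k + 1) - (T (k + 1) : ℝ)⁻¹) atTop
      (𝓝 L) := by
    simpa using ((tendsto_add_atTop_iff_nat 1).2 hL).sub ((tendsto_add_atTop_iff_nat 1).2 hTinv)
  have hhi : Tendsto (fun k : ℕ => (k : ℝ) / T k + (T k : ℝ)⁻¹) atTop (𝓝 L) := by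
    simpa using hL.add hTinv
  refine tendsto_of_tendsto_of_tendsto_of_le_of_le' (hlo.comp hκ) (hhi.comp hκ) ?_ ?_
  · filter_upwards [eventually_ge_atTop 1] with n hn
    have h1 := hv (hκ1 n)
    rw [hvT] at h1
    have hn' : (0 : ℝ) < n := by exact_mod_cast hn
    have h2 : (n : ℝ) ≤ T (κ n + 1) := by exact_mod_cast (hκ2 n).le
    calc ((κ n + 1 : ℕ) : ℝ) / T (κ n + 1) - (T (κ n + 1) : ℝ)⁻¹
        = (κ n : ℝ) / T (κ n + 1) := by push_cast; ring
      _ ≤ (κ n : ℝ) / n := by gcongr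
      _ ≤ v n / n := by gcongr
  · filter_upwards [hκ.eventually_ge_atTop 1] with n hn
    have h1 := hv (hκ2 n).le
    rw [hvT] at h1
    have hpos : (0 : ℝ) < T (κ n) := by
      have := hT.le_apply (x := κ n)
      exact_mod_cast (by lia : 0 < T (κ n))
    have h2 : (T (κ n) : ℝ) ≤ n := by exact_mod_cast hκ1 n
    calc v n / n ≤ ((κ n + 1 : ℕ) : ℝ) / n := by gcongr
      _ ≤ ((κ n + 1 : ℕ) : ℝ) / T (κ n) := by gcongr
      _ = (κ n : ℝ) / T (κ n) + (T (κ n) : ℝ)⁻¹ := by push_cast; ring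

/-- The time of the `k`-th visit to `j`, provided that `j` is visited infinitely often. -/
noncomputable def visitTime (j : S) (k : ℕ) (x : ℕ → S) : ℕ :=
  ∑ i ∈ Finset.range k, firstHit j ((afterHit j)^[i] x)

theorem iterate_afterHit (j : S) (k : ℕ) (x : ℕ → S) :
    (afterHit j)^[k] x = shift (visitTime j k x) x := by
  induction k with
  | zero => rfl
  | succ k ih =>
    rw [Function.iterate_succ_apply', visitTime, Finset.sum_range_succ, ← visitTime, afterHit, ih]
    funext n
    simp only [shift]
    congr 1
    lia

theorem mem_pathFreqTendsto_of_visitTime {j : S} {x : ℕ → S} {L : ℝ}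
    (hx : ∀ k, (afterHit j)^[k] x ∈ hits j)
    (hL : Tendsto (fun k : ℕ => (k : ℝ) / visitTime j k x) atTop (𝓝 L)) :
    x ∈ pathFreqTendsto j L := by
  have hsucc : ∀ k, visitTime j (k + 1) x =
      firstHit j ((afterHit j)^[k] x) + visitTime j k x := fun k => by
    rw [visitTime, Finset.sum_range_succ, ← visitTime, add_comm]
  refine tendsto_div_of_tendsto_div (pathVisits_mono j x) ?_ (by simp [visitTime]) ?_ hL
  · refine strictMono_nat_of_lt_succ fun k => ?_
    rw [hsucc]
    have := (firstHit_spec (hx k)).1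
    lia
  · intro k
    induction k with
    | zero => simp [visitTime, pathVisits_zero]
    | succ k ih =>
      rw [hsucc, pathVisits_add, ih, ← iterate_afterHit, pathVisits_firstHit (hx k)]
      push_cast
      ring

end Frequency


/-! ### The law of large numbers for the return times -/

section LawOfLargeNumbers

variable {S : Type*} [Countable S] [MeasurableSpace S] [MeasurableSingletonClass S]
  {p : S → PMF S} {j : S}

theorem IsRecurrent.ae_mem_hits (h : IsRecurrent p j) : ∀ᵐ x ∂pathLaw p j, x ∈ hits j :=
  (mem_ae_iff_prob_eq_one (measurableSet_hits j)).2 h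

/-- For a recurrent state `j`, the chain started at `j` starts afresh at its first return. -/
theorem IsRecurrent.measurePreserving_afterHit (h : IsRecurrent p j) :
    MeasurePreserving (afterHit j) (pathLaw p j) (pathLaw p j) := by
  refine ⟨measurable_afterHit j, Measure.ext fun A hA => ?_⟩
  rw [Measure.map_apply (measurable_afterHit j) hA,
    ← measure_inter_conull ((mem_ae_iff (s := hits j)).1 h.ae_mem_hits), Set.inter_comm,
    hits_eq_preimage,
    pathLaw_firstHit_inter_afterHit p j j (by simp) hA, ← hits_eq_preimage]
  exact (congrArg (· * pathLaw p j A) h).trans (one_mul _)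

/-- For a recurrent state, the first return time and the trajectory after the first return are
independent. -/
theorem IsRecurrent.indepFun_firstHit_afterHit (h : IsRecurrent p j) :
    firstHit j ⟂ᵢ[pathLaw p j] afterHit j := by
  rw [indepFun_iff_measure_inter_preimage_eq_mul]
  intro s A _ hA
  have hnull := (mem_ae_iff (s := hits j)).1 h.ae_mem_hits
  -- The value `0`, which stands for no return, has probability zero.
  have hs : firstHit j ⁻¹' s ∩ hits j = firstHit j ⁻¹' (s \ {0}) := by
    rw [hits_eq_preimage, ← Set.preimage_inter, Set.sdiff_eq]
  rw [← measure_inter_conull hnull, Set.inter_right_comm, hs,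
    pathLaw_firstHit_inter_afterHit p j j (by simp) hA, ← hs, measure_inter_conull hnull,
    h.measurePreserving_afterHit.measure_preimage hA.nullMeasurableSet]

/-- For a recurrent state, the times between consecutive returns are pairwise independent. -/
theorem IsRecurrent.pairwise_indepFun (h : IsRecurrent p j) (g : ℕ → ℝ) :
    Pairwise fun k l : ℕ =>
      (fun x : ℕ → S => g (firstHit j ((afterHit j)^[k] x))) ⟂ᵢ[pathLaw p j]
        (fun x => g (firstHit j ((afterHit j)^[l] x))) := by
  -- The `l`-th time, `k < l`, is a function of the trajectory after the `(k + 1)`-st return, while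
  -- the `k`-th time is the first return time of the trajectory after the `k`-th return.
  have hlt : ∀ k m : ℕ, (fun x : ℕ → S => g (firstHit j ((afterHit j)^[k] x)))
      ⟂ᵢ[pathLaw p j] (fun x => g (firstHit j ((afterHit j)^[m + 1 + k] x))) := by
    intro k m
    have hg : Measurable g := measurable_of_countable g
    have hf : Measurable fun x : ℕ → S => g (firstHit j ((afterHit j)^[m] x)) :=
      hg.comp ((measurable_firstHit j).comp ((measurable_afterHit j).iterate m))
    have h0 := h.indepFun_firstHit_afterHit.comp hg hf
    rw [indepFun_iff_measure_inter_preimage_eq_mul] at h0 ⊢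
    intro s t hs ht
    have hk := h.measurePreserving_afterHit.iterate k
    have hA := (hg.comp (measurable_firstHit j)) hs
    have hB := (hf.comp (measurable_afterHit j)) ht
    have h1 := h0 s t hs ht
    rw [← hk.measure_preimage (hA.inter hB).nullMeasurableSet,
      ← hk.measure_preimage hA.nullMeasurableSet,
      ← hk.measure_preimage hB.nullMeasurableSet] at h1
    have ht' : (fun x : ℕ → S => g (firstHit j ((afterHit j)^[m + 1 + k] x))) ⁻¹' t =
        (afterHit j)^[k] ⁻¹'
          (((fun x => g (firstHit j ((afterHit j)^[m] x))) ∘ afterHit j) ⁻¹' t) := by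
      ext x
      simp only [Set.mem_preimage, Function.comp_apply, Function.iterate_add_apply,
        Function.iterate_one]
    rw [ht']
    exact h1
  intro k l hkl
  rcases lt_or_gt_of_ne hkl with hkl | hkl
  · obtain ⟨m, rfl⟩ := Nat.exists_eq_add_of_lt hkl
    rw [show k + m + 1 = m + 1 + k by lia]
    exact hlt k m
  · obtain ⟨m, rfl⟩ := Nat.exists_eq_add_of_lt hkl
    rw [show l + m + 1 = m + 1 + l by lia]
    exact (hlt l m).symm

theorem IsRecurrent.ae_tendsto_average (h : IsRecurrent p j) (g : ℕ → ℝ)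
    (hg : Integrable (fun x => g (firstHit j x)) (pathLaw p j)) :
    ∀ᵐ x ∂pathLaw p j, Tendsto
      (fun n : ℕ => (∑ i ∈ Finset.range n, g (firstHit j ((afterHit j)^[i] x))) / n) atTop
      (𝓝 (∫ x, g (firstHit j x) ∂pathLaw p j)) := by
  refine strong_law_ae_real (fun i x => g (firstHit j ((afterHit j)^[i] x))) hg
    (h.pairwise_indepFun g) fun i => ?_
  have hm : Measurable fun x : ℕ → S => g (firstHit j x) :=
    (measurable_of_countable g).comp (measurable_firstHit j)
  have hi := h.measurePreserving_afterHit.iterate i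
  refine ⟨(hm.comp hi.measurable).aemeasurable, hm.aemeasurable, ?_⟩
  have hmap := Measure.map_map (μ := pathLaw p j) hm hi.measurable
  rw [hi.map_eq] at hmap
  exact hmap.symm

theorem IsRecurrent.ae_forall_iterate_mem_hits (h : IsRecurrent p j) :
    ∀ᵐ x ∂pathLaw p j, ∀ k, (afterHit j)^[k] x ∈ hits j :=
  ae_all_iff.2 fun k =>
    (h.measurePreserving_afterHit.iterate k).quasiMeasurePreserving.ae h.ae_mem_hits

theorem IsRecurrent.meanReturnTime_eq (h : IsRecurrent p j) :
    meanReturnTime p j = ∫⁻ x, (firstHit j x : ℝ≥0∞) ∂pathLaw p j :=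
  lintegral_congr_ae (h.ae_mem_hits.mono fun _ hx => returnTime_eq hx)

theorem one_le_meanReturnTime (p : S → PMF S) (j : S) : 1 ≤ meanReturnTime p j := by
  have h1 : ∫⁻ _, 1 ∂pathLaw p j = 1 := by simp
  rw [← h1]
  exact lintegral_mono fun x => le_iInf₂ fun n hn => Nat.one_le_cast.2 hn.1

theorem integral_natCast_firstHit (g : ℕ → ℕ) :
    ∫ x, (g (firstHit j x) : ℝ) ∂pathLaw p j =
      (∫⁻ x, (g (firstHit j x) : ℝ≥0∞) ∂pathLaw p j).toReal := by
  rw [← integral_toReal]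
  · simp
  · exact ((measurable_of_countable fun n => (g n : ℝ≥0∞)).comp
      (measurable_firstHit j)).aemeasurable
  · exact ae_of_all _ fun x => ENNReal.natCast_lt_top _

theorem integrable_natCast_firstHit {g : ℕ → ℕ}
    (hg : ∫⁻ x, (g (firstHit j x) : ℝ≥0∞) ∂pathLaw p j < ∞) :
    Integrable (fun x => (g (firstHit j x) : ℝ)) (pathLaw p j) := by
  have h := integrable_toReal_of_lintegral_ne_top (μ := pathLaw p j)
    (f := fun x => (g (firstHit j x) : ℝ≥0∞))
    ((measurable_of_countable fun n => (g n : ℝ≥0∞)).comp (measurable_firstHit j)).aemeasurable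
    hg.ne
  simpa using h

theorem IsPositiveRecurrent.toReal_meanReturnTime_ne_zero (h : IsPositiveRecurrent p j) :
    (meanReturnTime p j).toReal ≠ 0 :=
  (ENNReal.toReal_pos (zero_lt_one.trans_le (one_le_meanReturnTime p j)).ne' h.2.ne).ne'

theorem IsPositiveRecurrent.ae_mem_pathFreqTendsto (h : IsPositiveRecurrent p j) :
    ∀ᵐ x ∂pathLaw p j, x ∈ pathFreqTendsto j (1 / (meanReturnTime p j).toReal) := by
  have hint := h.2
  rw [h.1.meanReturnTime_eq] at hint
  filter_upwards [h.1.ae_forall_iterate_mem_hits, h.1.ae_tendsto_average (fun n => (n : ℝ))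
    (integrable_natCast_firstHit (g := fun n => n) hint)] with x hx hlim
  refine mem_pathFreqTendsto_of_visitTime hx ?_
  rw [integral_natCast_firstHit (fun n => n), ← h.1.meanReturnTime_eq] at hlim
  have hinv := hlim.inv₀ h.toReal_meanReturnTime_ne_zero
  rw [one_div]
  refine hinv.congr fun k => ?_
  rw [inv_div, visitTime, Nat.cast_sum]

theorem lintegral_min_firstHit_lt_top (c : ℕ) :
    ∫⁻ x, ((min (firstHit j x) c : ℕ) : ℝ≥0∞) ∂pathLaw p j < ∞ :=
  (lintegral_mono (g := fun _ => (c : ℝ≥0∞))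
    fun x => Nat.cast_le.2 (min_le_right _ c)).trans_lt (by simp)

/-- By monotone convergence, the truncated return times of a null recurrent state have arbitrarily
large expected values. -/
theorem IsNullRecurrent.exists_lt_integral_min (h : IsNullRecurrent p j) (K : ℝ) :
    ∃ c : ℕ, K < ∫ x, ((min (firstHit j x) c : ℕ) : ℝ) ∂pathLaw p j := by
  have hlim : Tendsto (fun c : ℕ => ∫⁻ x, ((min (firstHit j x) c : ℕ) : ℝ≥0∞) ∂pathLaw p j) atTop
      (𝓝 (∫⁻ x, (firstHit j x : ℝ≥0∞) ∂pathLaw p j)) := by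
    refine lintegral_tendsto_of_tendsto_of_monotone (fun c => ?_) (ae_of_all _ fun x c d hcd => ?_)
      (ae_of_all _ fun x => ?_)
    · exact ((measurable_of_countable fun n : ℕ => ((min n c : ℕ) : ℝ≥0∞)).comp
        (measurable_firstHit j)).aemeasurable
    · exact Nat.cast_le.2 (min_le_min_left _ hcd)
    · refine tendsto_const_nhds.congr' ?_
      filter_upwards [eventually_ge_atTop (firstHit j x)] with c hc
      rw [min_eq_left hc]
  rw [← h.1.meanReturnTime_eq, h.2] at hlim
  obtain ⟨c, hc⟩ := (hlim.eventually (lt_mem_nhds (ENNReal.ofReal_lt_top (r := K)))).exists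
  refine ⟨c, ?_⟩
  rw [integral_natCast_firstHit fun n => min n c]
  calc K ≤ (ENNReal.ofReal K).toReal := by rw [ENNReal.toReal_ofReal']; exact le_max_left K 0
    _ < _ := ENNReal.toReal_strict_mono (lintegral_min_firstHit_lt_top c).ne hc

/-- If the mean return time is infinite, then the averages of the truncated return times show
that the `k`-th visit time grows faster than linearly. -/
theorem IsNullRecurrent.ae_mem_pathFreqTendsto (h : IsNullRecurrent p j) :
    ∀ᵐ x ∂pathLaw p j, x ∈ pathFreqTendsto j 0 := by
  have hall := ae_all_iff.2 fun c : ℕ => h.1.ae_tendsto_average (fun n => ((min n c : ℕ) : ℝ))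
    (integrable_natCast_firstHit (g := fun n => min n c) (lintegral_min_firstHit_lt_top c))
  filter_upwards [h.1.ae_forall_iterate_mem_hits, hall] with x hx hlim
  refine mem_pathFreqTendsto_of_visitTime hx ?_
  have htop : Tendsto (fun k : ℕ => (visitTime j k x : ℝ) / k) atTop atTop := by
    refine tendsto_atTop.2 fun K => ?_
    obtain ⟨c, hc⟩ := h.exists_lt_integral_min K
    filter_upwards [(hlim c).eventually (lt_mem_nhds hc)] with k hk
    refine hk.le.trans ?_
    rw [visitTime, Nat.cast_sum]
    gcongr
    exact min_le_left _ _
  refine (tendsto_inv_atTop_zero.comp htop).congr fun k => ?_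
  rw [Function.comp_apply, inv_div]

end LawOfLargeNumbers

/-! ### Arbitrary initial states and distributions -/

section Initial

variable {S : Type*} [Countable S] [MeasurableSpace S] [MeasurableSingletonClass S]
  {p : S → PMF S} {j : S}

/-- A frequency that does not tend to `0` forces a return to `j`, and the frequency after this
return does not tend to `0` either. So the probability `q` of this event satisfies `q = f j j * q`,
which leaves only `q = 0` if `f j j < 1`. -/
theorem IsTransient.ae_mem_pathFreqTendsto (h : IsTransient p j) :
    ∀ᵐ x ∂pathLaw p j, x ∈ pathFreqTendsto j 0 := by
  rw [ae_iff]
  change pathLaw p j (pathFreqTendsto j 0)ᶜ = 0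
  have hsub : hits j ∩ (pathFreqTendsto j 0)ᶜ = (pathFreqTendsto j 0)ᶜ :=
    Set.inter_eq_right.2 fun x hx =>
      by_contra fun hx' => hx (mem_pathFreqTendsto_of_notMem_hits hx')
  have hq := pathLaw_hits_inter p j j (measurableSet_pathFreqTendsto j 0).compl
    fun x _ => not_congr (afterHit_mem_pathFreqTendsto_iff x)
  rw [hsub] at hq
  by_contra h0
  have hlt := ENNReal.mul_lt_mul_left h0 (measure_ne_top _ _) h
  rw [one_mul, ← hq] at hlt
  exact lt_irrefl _ hlt

/-- An event that contains all trajectories avoiding `j` and does not depend on what happens before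
the first visit to `j` is almost sure from every initial state as soon as it is from `j`. -/
theorem ae_pathLaw_of_ae_pathLaw_self (i : S) {A : Set (ℕ → S)} (hA : MeasurableSet A)
    (hinv : ∀ x ∈ hits j, afterHit j x ∈ A ↔ x ∈ A) (hsub : (hits j)ᶜ ⊆ A)
    (h : ∀ᵐ x ∂pathLaw p j, x ∈ A) : ∀ᵐ x ∂pathLaw p i, x ∈ A := by
  have hc : hits j ∩ Aᶜ = Aᶜ :=
    Set.inter_eq_right.2 fun x hx => by_contra fun hx' => hx (hsub hx')
  have hq := pathLaw_hits_inter p i j hA.compl fun x hx => not_congr (hinv x hx)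
  rw [hc, (mem_ae_iff (s := A)).1 h, mul_zero] at hq
  exact mem_ae_iff.2 hq

theorem IsMarkovChain.measure_eq_one {Ω : Type*} [MeasurableSpace Ω] {μ : Measure Ω}
    [IsProbabilityMeasure μ] {X : ℕ → Ω → S} (hX : IsMarkovChain μ p X)
    {A : Set (ℕ → S)} (hA : MeasurableSet A) (h : ∀ i, ∀ᵐ x ∂pathLaw p i, x ∈ A) :
    μ {ω | (fun n => X n ω) ∈ A} = 1 := by
  have hm : Measurable fun ω n => X n ω := measurable_pi_lambda _ hX.measurable
  have hc := hX.measure_eq_tsum hA.compl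
  rw [ENNReal.tsum_eq_zero.2 fun i => by rw [(mem_ae_iff (s := A)).1 (h i), mul_zero]] at hc
  exact (prob_compl_eq_zero_iff (hm hA)).1 hc

theorem IsPositiveRecurrent.ae_mem_union (h : IsPositiveRecurrent p j) (i : S) :
    ∀ᵐ x ∂pathLaw p i, x ∈ pathFreqTendsto j (1 / (meanReturnTime p j).toReal) ∪
      pathFreqTendsto j 0 :=
  ae_pathLaw_of_ae_pathLaw_self i
    ((measurableSet_pathFreqTendsto j _).union (measurableSet_pathFreqTendsto j 0))
    (fun x _ => or_congr (afterHit_mem_pathFreqTendsto_iff x) (afterHit_mem_pathFreqTendsto_iff x))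
    (fun _ hx => Or.inr (mem_pathFreqTendsto_of_notMem_hits hx))
    (h.ae_mem_pathFreqTendsto.mono fun _ hx => Or.inl hx)

theorem IsPositiveRecurrent.pathLaw_pathFreqTendsto (h : IsPositiveRecurrent p j) (i : S) :
    pathLaw p i (pathFreqTendsto j (1 / (meanReturnTime p j).toReal)) = hitProb p i j := by
  have hm := measurableSet_pathFreqTendsto j (1 / (meanReturnTime p j).toReal)
  have hsub : hits j ∩ pathFreqTendsto j (1 / (meanReturnTime p j).toReal) =
      pathFreqTendsto j (1 / (meanReturnTime p j).toReal) :=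
    Set.inter_eq_right.2 fun x hx => by_contra fun hx' =>
      Set.disjoint_left.1
        (disjoint_pathFreqTendsto (one_div_ne_zero h.toReal_meanReturnTime_ne_zero)) hx
        (mem_pathFreqTendsto_of_notMem_hits hx')
  have hq := pathLaw_hits_inter p i j hm fun x _ => afterHit_mem_pathFreqTendsto_iff x
  rwa [hsub, (mem_ae_iff_prob_eq_one hm).1 h.ae_mem_pathFreqTendsto, mul_one] at hq

theorem IsPositiveRecurrent.pathLaw_pathFreqTendsto_zero (h : IsPositiveRecurrent p j) (i : S) :
    pathLaw p i (pathFreqTendsto j 0) = 1 - hitProb p i j := by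
  have h0 := measurableSet_pathFreqTendsto j (0 : ℝ)
  have hm := measurableSet_pathFreqTendsto j (1 / (meanReturnTime p j).toReal)
  have h1 := (mem_ae_iff_prob_eq_one (hm.union h0)).1 (h.ae_mem_union i)
  rw [measure_union (disjoint_pathFreqTendsto (one_div_ne_zero h.toReal_meanReturnTime_ne_zero)) h0,
    add_comm] at h1
  rw [← h.pathLaw_pathFreqTendsto i]
  exact ENNReal.eq_sub_of_add_eq (measure_ne_top _ _) h1

end Initial

end MarkovChain

theorem mainTheorem2 {S : Type*} [Countable S] [MeasurableSpace S] [MeasurableSingletonClass S]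
    {Ω : Type*} [MeasurableSpace Ω] (μ : Measure Ω) [IsProbabilityMeasure μ]
    (p : S → PMF S) (X : ℕ → Ω → S) (hX : MarkovChain.IsMarkovChain μ p X) (j : S) :
    (MarkovChain.IsPositiveRecurrent p j →
      (∃ E : Set Ω, MeasurableSet E ∧ μ E = 0 ∧
        MarkovChain.freqTendsto X j (1 / (MarkovChain.meanReturnTime p j).toReal) ∪
          MarkovChain.freqTendsto X j 0 = Set.univ \ E) ∧
      μ (MarkovChain.freqTendsto X j (1 / (MarkovChain.meanReturnTime p j).toReal)) =
        ∑' i, μ {ω | X 0 ω = i} * MarkovChain.hitProb p i j ∧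
      μ (MarkovChain.freqTendsto X j 0) =
        ∑' i, μ {ω | X 0 ω = i} * (1 - MarkovChain.hitProb p i j)) ∧
    (MarkovChain.IsNullRecurrent p j ∨ MarkovChain.IsTransient p j →
      μ (MarkovChain.freqTendsto X j 0) = 1) := by

  have hm : Measurable fun ω n => X n ω := measurable_pi_lambda _ hX.measurable
  have h0 := MarkovChain.measurableSet_pathFreqTendsto j (0 : ℝ)
  constructor
  · intro h
    have h1 := MarkovChain.measurableSet_pathFreqTendsto j
      (1 / (MarkovChain.meanReturnTime p j).toReal)
    refine ⟨⟨_, (hm (h1.union h0)).compl, ?_, (Set.compl_eq_univ_sdiff _ ▸ compl_compl _).symm⟩,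
      ?_, ?_⟩
    · rw [prob_compl_eq_zero_iff (hm (h1.union h0))]
      exact hX.measure_eq_one (h1.union h0) h.ae_mem_union
    · refine (hX.measure_eq_tsum h1).trans (tsum_congr fun i => ?_)
      rw [h.pathLaw_pathFreqTendsto i]
    · refine (hX.measure_eq_tsum h0).trans (tsum_congr fun i => ?_)
      rw [h.pathLaw_pathFreqTendsto_zero i]
  · intro h
    refine hX.measure_eq_one h0 fun i => ?_
    refine MarkovChain.ae_pathLaw_of_ae_pathLaw_self i h0
      (fun x _ => MarkovChain.afterHit_mem_pathFreqTendsto_iff x)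
      (fun _ hx => MarkovChain.mem_pathFreqTendsto_of_notMem_hits hx) ?_
    exact h.elim (fun h => h.ae_mem_pathFreqTendsto) fun h => h.ae_mem_pathFreqTendsto
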